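/- Theorem 4.1. Let $0<I_1<I_2<I_3$ and $l>0$, and put $a=1/I_1$, $b=1/I_2$, $c=1/I_3$. On the sphere $\frac12(p_1^2+p_2^2+p_3^2)=l$ in $\mathbb{R}^3$ consider the Hamiltonian of the free rigid body $$H=\tfrac12\left(\frac{p_1^2}{I_1}+\frac{p_2^2}{I_2}+\frac{p_3^2}{I_3}\right)$$ and the symplectic form, normalized as $$\omega=\frac{dp_1\wedge dp_2}{3p_3}=\frac{dp_2\wedge dp_3}{3p_1}=\frac{dp_3\wedge dp_1}{3p_2}.$$ Let $P_0$ be one of the two elliptic equilibria $(\pm\sqrt{2l},0,0)$. A Birkhoff normal form of $H$ at $P_0$ is a function $\mathcal{H}_1$ of one real variable, analytic near $0$ with $\mathcal{H}_1'(0)\neq 0$, such that in some real analytic local coordinates $(x,y)$ on the sphere, centred at $P_0$ and with $\omega=dx\wedge dy$, one has $H=\mathcal{H}_1\left(\frac{x^2+y^2}{2}\right)$ near $P_0$; in particular $\mathcal{H}_1(0)=H(P_0)=l/I_1$. Such a normal form exists. If $\Phi_1$ denotes the local inverse of $\mathcal{H}_1$ near $l/I_1$ (so $\Phi_1(l/I_1)=0$),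 then for all real $h$ in a neighbourhood of $l/I_1$ the function $\Phi_1$ is differentiable at $h$ and, with $d=h/l$, $$\Phi_1'(h)=-\frac{1}{3\pi}\sqrt{\frac{2}{l}}\,\frac{1}{\sqrt{(d-c)(a-b)}}\,\mathcal{K}\!\left(\frac{(d-a)(b-c)}{(d-c)(b-a)}\right)=:S(a,b,c,d),$$ where $\mathcal{K}(\lambda)=\int_0^1\frac{dx}{\sqrt{(1-x^2)(1-\lambda x^2)}}$ is the complete elliptic integral of the first kind. -/

import Mathlib

open Filter Topology
open scoped Matrix

noncomputable section

namespace FreeRigidBody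

/-- Half the squared norm of the angular momentum `P = (p₁, p₂, p₃)`. The reduced phase space
(coadjoint orbit) is the level set `casimir P = l`, a sphere of radius `√(2l)`. -/
def casimir (P : Fin 3 → ℝ) : ℝ := (P 0 ^ 2 + P 1 ^ 2 + P 2 ^ 2) / 2

/-- The Hamiltonian of the free rigid body with principal moments of inertia `I₁, I₂, I₃`. -/
def energy (I₁ I₂ I₃ : ℝ) (P : Fin 3 → ℝ) : ℝ :=
  (P 0 ^ 2 / I₁ + P 1 ^ 2 / I₂ + P 2 ^ 2 / I₃) / 2

/-- The symplectic form on the spheres centred at the origin, evaluated on vectors `u`, `v`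
tangent at `P`, with the normalization
`ω = dp₁ ∧ dp₂ / (3 p₃) = dp₂ ∧ dp₃ / (3 p₁) = dp₃ ∧ dp₁ / (3 p₂)`.
The three coordinate expressions are the lemmas `orbitForm_eq₁`, `orbitForm_eq₂`,
`orbitForm_eq₃` below. -/
def orbitForm (P u v : Fin 3 → ℝ) : ℝ := (P ⬝ᵥ (u ⨯₃ v)) / (3 * (P ⬝ᵥ P))

lemma dotProduct_self_ne_zero (P : Fin 3 → ℝ) (i : Fin 3) (h : P i ≠ 0) : P ⬝ᵥ P ≠ 0 := by
  intro h0
  exact h (congrFun (dotProduct_self_eq_zero.mp h0) i)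

lemma orbitForm_eq₁ (P u v : Fin 3 → ℝ) (hu : P ⬝ᵥ u = 0) (hv : P ⬝ᵥ v = 0) (h : P 0 ≠ 0) :
    orbitForm P u v = (u 1 * v 2 - u 2 * v 1) / (3 * P 0) := by
  have hP := dotProduct_self_ne_zero P 0 h
  rw [orbitForm, div_eq_div_iff (by positivity) (by positivity)]
  simp [dotProduct, Fin.sum_univ_three, cross_apply] at hu hv ⊢
  linear_combination (3 * P 2 * v 1 - 3 * P 1 * v 2) * hu
    + (3 * P 1 * u 2 - 3 * P 2 * u 1) * hv

lemma orbitForm_eq₂ (P u v : Fin 3 → ℝ) (hu : P ⬝ᵥ u = 0) (hv : P ⬝ᵥ v = 0) (h : P 1 ≠ 0) :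
    orbitForm P u v = (u 2 * v 0 - u 0 * v 2) / (3 * P 1) := by
  have hP := dotProduct_self_ne_zero P 1 h
  rw [orbitForm, div_eq_div_iff (by positivity) (by positivity)]
  simp [dotProduct, Fin.sum_univ_three, cross_apply] at hu hv ⊢
  linear_combination (3 * P 0 * v 2 - 3 * P 2 * v 0) * hu
    + (3 * P 2 * u 0 - 3 * P 0 * u 2) * hv

lemma orbitForm_eq₃ (P u v : Fin 3 → ℝ) (hu : P ⬝ᵥ u = 0) (hv : P ⬝ᵥ v = 0) (h : P 2 ≠ 0) :
    orbitForm P u v = (u 0 * v 1 - u 1 * v 0) / (3 * P 2) := by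
  have hP := dotProduct_self_ne_zero P 2 h
  rw [orbitForm, div_eq_div_iff (by positivity) (by positivity)]
  simp [dotProduct, Fin.sum_univ_three, cross_apply] at hu hv ⊢
  linear_combination (3 * P 1 * v 0 - 3 * P 0 * v 1) * hu
    + (3 * P 0 * u 1 - 3 * P 1 * u 0) * hv

/-- `ψ` is (the inverse of) an analytic Darboux chart `(x, y)` of the sphere `casimir = l`,
centred at `P₀`: it parametrizes the sphere near `P₀` and `ψ^* ω = dx ∧ dy`. The last
condition forces `ψ` to be an immersion, hence a local diffeomorphism onto the sphere. -/
structure IsDarbouxChart (l : ℝ) (P₀ : Fin 3 → ℝ) (ψ : ℝ × ℝ → Fin 3 → ℝ) : Prop where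
  analyticAt : AnalyticAt ℝ ψ 0
  map_zero : ψ 0 = P₀
  mem_orbit : ∀ᶠ z in 𝓝 (0 : ℝ × ℝ), casimir (ψ z) = l
  pullback_form : ∀ᶠ z in 𝓝 (0 : ℝ × ℝ),
    orbitForm (ψ z) (fderiv ℝ ψ z (1, 0)) (fderiv ℝ ψ z (0, 1)) = 1

/-- `N` is a (convergent) Birkhoff normal form, at the elliptic equilibrium `P₀`, of the function
`H` on the sphere `casimir = l`: `N` is analytic and invertible around `0`, and in a suitable
analytic Darboux chart centred at `P₀` one has `H = N ((x² + y²) / 2)`. The constant term of `N`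
is the value `H P₀`. -/
structure IsBirkhoffNormalForm (l : ℝ) (H : (Fin 3 → ℝ) → ℝ) (P₀ : Fin 3 → ℝ) (N : ℝ → ℝ) :
    Prop where
  analyticAt : AnalyticAt ℝ N 0
  deriv_ne_zero : deriv N 0 ≠ 0
  exists_chart : ∃ ψ : ℝ × ℝ → Fin 3 → ℝ, IsDarbouxChart l P₀ ψ ∧
    ∀ᶠ z in 𝓝 (0 : ℝ × ℝ), H (ψ z) = N ((z.1 ^ 2 + z.2 ^ 2) / 2)

/-- `Φ` is an inverse Birkhoff normal form of `H` at `P₀`: a local inverse, near the critical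
value `N 0 = H P₀`, of a Birkhoff normal form `N` of `H` at `P₀`. -/
def IsInverseBirkhoffNormalForm (l : ℝ) (H : (Fin 3 → ℝ) → ℝ) (P₀ : Fin 3 → ℝ) (Φ : ℝ → ℝ) :
    Prop :=
  ∃ N : ℝ → ℝ, IsBirkhoffNormalForm l H P₀ N ∧
    (∀ᶠ t in 𝓝 (0 : ℝ), Φ (N t) = t) ∧ ∀ᶠ h in 𝓝 (N 0), N (Φ h) = h

/-- The complete elliptic integral of the first kind, as a function of the parameter `lam = k²`. -/
def ellipticK (lam : ℝ) : ℝ :=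
  ∫ x in (0 : ℝ)..1, 1 / √((1 - x ^ 2) * (1 - lam * x ^ 2))

/-- The defining integral of `ellipticK lam` converges for `lam < 1`. -/
lemma intervalIntegrable_ellipticK (lam : ℝ) (hlam : lam < 1) :
    IntervalIntegrable (fun x : ℝ => 1 / √((1 - x ^ 2) * (1 - lam * x ^ 2)))
      MeasureTheory.volume 0 1 := by
  have h1 : IntervalIntegrable (fun x : ℝ => (1 - x) ^ (-(1 / 2) : ℝ))
      MeasureTheory.volume 0 1 := by
    have := (intervalIntegral.intervalIntegrable_rpow' (a := 1) (b := 0)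
      (r := (-(1 / 2) : ℝ)) (by norm_num)).comp_sub_left 1
    simpa using this
  have h2 : ContinuousOn (fun x : ℝ => 1 / √((1 + x) * (1 - lam * x ^ 2)))
      (Set.uIcc (0 : ℝ) 1) := by
    refine ContinuousOn.div (by fun_prop) (by fun_prop) ?_
    intro x hx
    rw [Set.uIcc_of_le zero_le_one] at hx
    have hx2 : x ^ 2 ≤ 1 := pow_le_one₀ hx.1 hx.2
    have : 0 < 1 - lam * x ^ 2 := by
      rcases le_or_gt lam 0 with h0 | h0
      · nlinarith [sq_nonneg x]
      · nlinarith [mul_le_mul_of_nonneg_left hx2 h0.le]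
    have : 0 < 1 + x := by linarith [hx.1]
    positivity
  refine (h1.mul_continuousOn h2).congr ?_
  intro x hx
  rw [Set.uIoc_of_le zero_le_one] at hx
  have h3 : 0 ≤ 1 - x := by linarith [hx.2]
  simp only
  rw [Real.rpow_neg h3, ← Real.sqrt_eq_rpow,
    show (1 - x ^ 2) * (1 - lam * x ^ 2) = (1 - x) * ((1 + x) * (1 - lam * x ^ 2)) by ring,
    Real.sqrt_mul h3, one_div, one_div, mul_inv]

/-- The function `S(a, b, c, d)` attached to the sphere `casimir = l`. -/
def periodS (l a b c d : ℝ) : ℝ :=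
  -(1 / (3 * Real.pi)) * √(2 / l) * (1 / √((d - c) * (a - b))) *
    ellipticK ((d - a) * (b - c) / ((d - c) * (b - a)))

end FreeRigidBody

end

/-! Put `A = a - b`, `B = a - c`. On the sphere, the coordinates `(√A p₂, √B p₃)` turn `H` into
`l/I₁ - (x² + y²)/2`, so its levels near `P₀` are circles, while `ω` becomes `σ f dx ∧ dy`, where `σ
= ±1` is the hemisphere and `f` is a positive analytic density. Everything is governed by the mean
`M(s)` of `f` over the circle `(x² + y²)/2 = s` and by the action `I` with `I' = M`, `I(0) = 0`.

Existence: `exists_normalizing_map` builds an explicit twist map `Z` with Jacobian `f` and `halfSq ∘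
Z = I ∘ halfSq`. Its rotation angle solves a cohomological equation along circles
(`exists_analyticAt_angular_primitive`), and its radial factor is `√(I(s)/s)`. Inverting `Z` gives a
Darboux chart in which `H` depends on the radius only.

Uniqueness: composing any chart of a normal form `N` with `Z` gives a map with Jacobian `±1` that
sends circles to circles. Comparing the areas of discs (`eventually_eq_of_abs_det_eq_one`) shows
that it keeps radii, so `I(l/I₁ - N(t)) = t`. Hence every inverse normal form is `h ↦ I(l/I₁ - h)`
near `l/I₁`, with derivative `-M(l/I₁ - h)`.

Finally `M` is an average of inverse square roots of an affine function of `cos²`, which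
`meanDensity_eq_neg_periodS` reduces to four quarter periods. -/

namespace FreeRigidBody

/-! ### Analyticity of averages -/

/-- A weighted average of pullbacks of an analytic function by a continuous family of linear maps
is analytic. -/
lemma analyticAt_integral_comp_clm {E E' : Type*} [NormedAddCommGroup E] [NormedSpace ℝ E]
    [NormedAddCommGroup E'] [NormedSpace ℝ E'] {F : E → ℝ} (hF : AnalyticAt ℝ F 0)
    {L : ℝ → E' →L[ℝ] E} (hL : Continuous L) {w : ℝ → ℝ} (hw : Continuous w) (a b : ℝ) :
    AnalyticAt ℝ (fun x => ∫ t in a..b, w t * F (L t x)) 0 := by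
  obtain ⟨p, hp⟩ := hF
  obtain ⟨C, r, hC, hr, hpr⟩ := p.le_mul_pow_of_radius_pos hp.radius_pos
  obtain ⟨ε, hε⟩ := hp
  obtain ⟨K₀, hK₀⟩ := isCompact_uIcc.exists_bound_of_continuousOn (s := Set.uIcc a b)
    hL.continuousOn
  obtain ⟨W, hW⟩ := isCompact_uIcc.exists_bound_of_continuousOn (s := Set.uIcc a b)
    hw.continuousOn
  have hW0 : 0 ≤ W := (norm_nonneg _).trans (hW a Set.left_mem_uIcc)
  set K := max K₀ 1 with hKdef
  have hK : ∀ t ∈ Set.uIcc a b, ‖L t‖ ≤ K := fun t ht => (hK₀ t ht).trans (le_max_left _ _)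
  have hK0 : 0 < K := lt_max_of_lt_right one_pos
  have hcont : ∀ n, Continuous (fun t => w t • (p n).compContinuousLinearMap (fun _ => L t)) := by
    intro n
    refine hw.smul ?_
    have h1 := (ContinuousMultilinearMap.compContinuousLinearMapContinuousMultilinear ℝ
      (fun _ : Fin n => E') (fun _ : Fin n => E) ℝ).cont.comp
      (continuous_pi fun _ => hL : Continuous fun t => (fun _ : Fin n => L t))
    exact h1.clm_apply continuous_const
  -- The power series of the average is integrated coefficient by coefficient.
  let q : FormalMultilinearSeries ℝ E' ℝ := fun n =>
    ∫ t in a..b, w t • (p n).compContinuousLinearMap (fun _ => L t)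
  have hnorm : ∀ n, ∀ t ∈ Set.uIcc a b,
      ‖w t • (p n).compContinuousLinearMap (fun _ => L t)‖ ≤ W * (C * r ^ n * K ^ n) := by
    intro n t ht
    rw [norm_smul]
    refine mul_le_mul (hW t ht) ?_ (norm_nonneg _) hW0
    refine (ContinuousMultilinearMap.norm_compContinuousLinearMap_le _ _).trans ?_
    rw [Finset.prod_const, Finset.card_univ, Fintype.card_fin]
    exact mul_le_mul (hpr n) (pow_le_pow_left₀ (norm_nonneg _) (hK t ht) n) (by positivity)
      (by positivity)
  have hq : ∀ n, ‖q n‖ ≤ W * (C * r ^ n * K ^ n) * |b - a| := fun n =>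
    intervalIntegral.norm_integral_le_of_norm_le_const
      fun t ht => hnorm n t (Set.uIoc_subset_uIcc ht)
  obtain ⟨δ, hδ, hδε⟩ : ∃ δ : NNReal, 0 < δ ∧ (δ : ENNReal) < ε :=
    let ⟨δ, h1, h2⟩ := ENNReal.lt_iff_exists_nnreal_btwn.1 hε.r_pos
    ⟨δ, by exact_mod_cast h1, h2⟩
  -- The first bound keeps every `L t y` inside the ball of convergence of `F`; the second makes the
  -- terms decay like `(1/2)^n`, uniformly in `t`.
  let ρ : ℝ := min (δ / K) (1 / (2 * r * K))
  have hρ : 0 < ρ := by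
    have : (0 : ℝ) < δ := hδ
    exact lt_min (by positivity) (by positivity)
  have hρ1 : K * ρ ≤ δ := by
    have := min_le_left ((δ : ℝ) / K) (1 / (2 * r * K))
    calc K * ρ ≤ K * (δ / K) := by gcongr
      _ = δ := by field_simp
  have hρ2 : r * K * ρ ≤ 1 / 2 := by
    have := min_le_right ((δ : ℝ) / K) (1 / (2 * r * K))
    calc r * K * ρ ≤ r * K * (1 / (2 * r * K)) := by gcongr
      _ = 1 / 2 := by field_simp
  refine ⟨q, ENNReal.ofReal ρ, ?_, by simpa using hρ, ?_⟩
  · refine q.le_radius_of_bound (W * C * |b - a|) fun n => ?_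
    rw [Real.coe_toNNReal _ hρ.le]
    calc ‖q n‖ * ρ ^ n ≤ W * (C * r ^ n * K ^ n) * |b - a| * ρ ^ n := by gcongr; exact hq n
      _ = W * C * |b - a| * (r * K * ρ) ^ n := by rw [mul_pow, mul_pow]; ring
      _ ≤ W * C * |b - a| * 1 := by
        gcongr
        exact pow_le_one₀ (by positivity) (hρ2.trans (by norm_num))
      _ = _ := mul_one _
  · intro y hy
    have hy' : ‖y‖ < ρ := by
      rw [Metric.mem_eball, edist_zero_right] at hy
      rwa [← ofReal_norm, ENNReal.ofReal_lt_ofReal_iff hρ] at hy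
    rw [zero_add]
    have happ : ∀ n, q n (fun _ => y) = ∫ t in a..b, w t * p n (fun _ => L t y) := by
      intro n
      have := (ContinuousMultilinearMap.apply ℝ (fun _ : Fin n => E') ℝ
        (fun _ => y)).intervalIntegral_comp_comm
        (μ := MeasureTheory.volume) ((hcont n).intervalIntegrable a b)
      exact this.symm
    simp only [happ]
    refine intervalIntegral.hasSum_integral_of_dominated_convergence
      (fun n _ => W * C * (1 / 2) ^ n) (fun n => ?_) (fun n => ?_) ?_ ?_ ?_
    · refine Continuous.aestronglyMeasurable ?_
      have := (ContinuousMultilinearMap.apply ℝ (fun _ : Fin n => E') ℝ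
        (fun _ => y)).continuous.comp (hcont n)
      exact this
    · refine Eventually.of_forall fun t ht => ?_
      have h1 := (w t • (p n).compContinuousLinearMap (fun _ => L t)).le_opNorm (fun _ => y)
      rw [Finset.prod_const, Finset.card_univ, Fintype.card_fin] at h1
      refine h1.trans ?_
      calc _ ≤ W * (C * r ^ n * K ^ n) * ρ ^ n := by
            gcongr
            exact hnorm n t (Set.uIoc_subset_uIcc ht)
        _ = W * C * (r * K * ρ) ^ n := by rw [mul_pow, mul_pow]; ring
        _ ≤ _ := by gcongr
    · exact Eventually.of_forall fun t _ => (summable_geometric_two).mul_left _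
    · exact intervalIntegrable_const
    · refine Eventually.of_forall fun t ht => ?_
      have hmem : L t y ∈ Metric.eball (0 : E) ε := by
        rw [Metric.mem_eball, edist_zero_right]
        refine lt_of_le_of_lt ?_ hδε
        rw [← ofReal_norm, ENNReal.ofReal_le_iff_le_toReal ENNReal.coe_ne_top]
        calc ‖L t y‖ ≤ ‖L t‖ * ‖y‖ := (L t).le_opNorm y
          _ ≤ K * ρ := by
            gcongr
            exact hK t (Set.uIoc_subset_uIcc ht)
          _ ≤ δ := hρ1
      have := (hε.hasSum hmem).mul_left (w t)
      rwa [zero_add] at this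

/-! ### Rotations and the cohomological equation on circles -/

/-- The rotation of the plane by the angle `t`. -/
noncomputable def rot (t : ℝ) : ℝ × ℝ →L[ℝ] ℝ × ℝ :=
  Real.cos t • ContinuousLinearMap.id ℝ (ℝ × ℝ) +
    Real.sin t • (-ContinuousLinearMap.snd ℝ ℝ ℝ).prod (ContinuousLinearMap.fst ℝ ℝ ℝ)

lemma rot_apply (t : ℝ) (z : ℝ × ℝ) :
    rot t z = (Real.cos t * z.1 - Real.sin t * z.2, Real.cos t * z.2 + Real.sin t * z.1) := by
  ext <;> simp [rot] ; ring

lemma continuous_rot : Continuous rot := by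
  unfold rot
  fun_prop

lemma rot_rot (s t : ℝ) (z : ℝ × ℝ) : rot s (rot t z) = rot (s + t) z := by
  simp only [rot_apply, Real.cos_add, Real.sin_add]
  ext <;> simp <;> ring

lemma hasDerivAt_rot_zero (z : ℝ × ℝ) : HasDerivAt (fun t => rot t z) (-z.2, z.1) 0 := by
  have h : (fun t => rot t z) =
      fun t => (Real.cos t * z.1 - Real.sin t * z.2, Real.cos t * z.2 + Real.sin t * z.1) :=
    funext fun t => rot_apply t z
  rw [h]
  have hc := Real.hasDerivAt_cos 0
  have hs := Real.hasDerivAt_sin 0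
  refine (((hc.mul_const z.1).sub (hs.mul_const z.2)).prodMk
    ((hc.mul_const z.2).add (hs.mul_const z.1))).congr_deriv ?_
  simp

/-- The product carries the sup norm, for which rotations are not isometries; a crude factor is
enough to control small circles. -/
lemma norm_rot_le (t : ℝ) (z : ℝ × ℝ) : ‖rot t z‖ ≤ 2 * ‖z‖ := by
  have h1 := norm_fst_le z
  have h2 := norm_snd_le z
  have hc := Real.abs_cos_le_one t
  have hs := Real.abs_sin_le_one t
  rw [Real.norm_eq_abs] at h1 h2
  rw [rot_apply, Prod.norm_def]
  have key : ∀ x y p q : ℝ, |x| ≤ ‖z‖ → |y| ≤ ‖z‖ → |p| ≤ 1 → |q| ≤ 1 →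
      |p * x| + |q * y| ≤ 2 * ‖z‖ := by
    intro x y p q hx hy hp hq
    rw [abs_mul, abs_mul]
    nlinarith [mul_le_mul hp hx (abs_nonneg _) zero_le_one,
      mul_le_mul hq hy (abs_nonneg _) zero_le_one]
  exact max_le ((abs_sub _ _).trans (key _ _ _ _ h1 h2 hc hs))
    ((abs_add_le _ _).trans (key _ _ _ _ h2 h1 hc hs))

/-- A property valid near the origin is valid on all sufficiently small circles. -/
lemma eventually_forall_rot {p : ℝ × ℝ → Prop} (hp : ∀ᶠ z in 𝓝 0, p z) :
    ∀ᶠ z in 𝓝 (0 : ℝ × ℝ), ∀ t, p (rot t z) := by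
  obtain ⟨ε, hε, h⟩ := Metric.eventually_nhds_iff.1 hp
  refine Metric.eventually_nhds_iff.2 ⟨ε / 2, by positivity, fun z hz t => h ?_⟩
  rw [dist_zero_right] at hz ⊢
  linarith [norm_rot_le t z]

/-- The averaging operator along circles solves the cohomological equation for the rotation
field. -/
lemma exists_analyticAt_angular_primitive {F : ℝ × ℝ → ℝ} (hF : AnalyticAt ℝ F 0) :
    ∃ g : ℝ × ℝ → ℝ, AnalyticAt ℝ g 0 ∧ ∀ᶠ z in 𝓝 0,
      fderiv ℝ g z (-z.2, z.1) =
        F z - (2 * Real.pi)⁻¹ * ∫ t in (0 : ℝ)..2 * Real.pi, F (rot t z) := by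
  -- The weight `t` is a sawtooth on the circle: differentiating along the flow leaves its jump,
  -- which gives the value of `F`, and its constant slope, which gives the mean.
  let G : ℝ × ℝ → ℝ := fun z => ∫ t in (0 : ℝ)..2 * Real.pi, t * F (rot t z)
  have hG : AnalyticAt ℝ G 0 := analyticAt_integral_comp_clm hF continuous_rot continuous_id _ _
  refine ⟨fun z => (2 * Real.pi)⁻¹ * G z, analyticAt_const.mul hG, ?_⟩
  have hFc := eventually_forall_rot (hF.eventually_analyticAt.mono fun z hz => hz.continuousAt)
  filter_upwards [hG.eventually_analyticAt, hFc] with z hz hc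
  have hpi := Real.pi_pos
  have hh : Continuous fun t => F (rot t z) := by
    rw [continuous_iff_continuousAt]
    intro t
    exact ContinuousAt.comp (f := fun t => rot t z) (hc t)
      (continuous_rot.clm_apply continuous_const).continuousAt
  have hper : Function.Periodic (fun t => F (rot t z)) (2 * Real.pi) := by
    intro t
    simp [rot_apply]
  have h0 : rot 0 z = z := by simp [rot_apply]
  -- Rotating the base point shifts the integration variable; periodicity then moves the mean back
  -- to `[0, 2π]`, and all dependence on `τ` becomes explicit.
  have hshift : ∀ τ, G (rot τ z) = (∫ t in τ..τ + 2 * Real.pi, t * F (rot t z)) -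
      τ * ∫ t in (0 : ℝ)..2 * Real.pi, F (rot t z) := by
    intro τ
    have h1 : G (rot τ z) = ∫ t in (0 : ℝ)..2 * Real.pi,
        (fun x => (x - τ) * F (rot x z)) (t + τ) := by
      simp only [G, rot_rot, add_sub_cancel_right]
    rw [h1, intervalIntegral.integral_comp_add_right (fun x => (x - τ) * F (rot x z)),
      zero_add, add_comm (2 * Real.pi) τ]
    simp only [sub_mul]
    rw [intervalIntegral.integral_sub, intervalIntegral.integral_const_mul,
      hper.intervalIntegral_add_eq τ 0, zero_add]
    · exact (continuous_id.mul hh).intervalIntegrable _ _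
    · exact (continuous_const.mul hh).intervalIntegrable _ _
  have hk : Continuous fun t => t * F (rot t z) := continuous_id.mul hh
  have hd1 : HasDerivAt (fun τ => G (rot τ z))
      (2 * Real.pi * F z - ∫ t in (0 : ℝ)..2 * Real.pi, F (rot t z)) 0 := by
    have hsplit : ∀ τ, ∫ t in τ..τ + 2 * Real.pi, t * F (rot t z) =
        (∫ t in (0 : ℝ)..τ + 2 * Real.pi, t * F (rot t z)) - ∫ t in (0 : ℝ)..τ, t * F (rot t z) :=
      fun τ => (intervalIntegral.integral_interval_sub_left (hk.intervalIntegrable _ _)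
        (hk.intervalIntegrable _ _)).symm
    rw [funext fun τ => (hshift τ).trans (congrArg (· - _) (hsplit τ))]
    have ha : HasDerivAt (fun τ => ∫ t in (0 : ℝ)..τ + 2 * Real.pi, t * F (rot t z))
        ((0 + 2 * Real.pi) * F (rot (0 + 2 * Real.pi) z)) 0 :=
      (hk.integral_hasStrictDerivAt 0 (0 + 2 * Real.pi)).hasDerivAt.comp_add_const 0 (2 * Real.pi)
    have hb := (hk.integral_hasStrictDerivAt 0 0).hasDerivAt
    refine ((ha.sub hb).sub ((hasDerivAt_id (0 : ℝ)).mul_const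
      (∫ t in (0 : ℝ)..2 * Real.pi, F (rot t z)))).congr_deriv ?_
    have := hper 0
    simp only [h0] at this
    rw [this]
    ring
  have hd2 : HasDerivAt (fun τ => G (rot τ z)) (fderiv ℝ G z (-z.2, z.1)) 0 := by
    have := hz.differentiableAt.hasFDerivAt
    rw [← h0] at this
    have := this.comp_hasDerivAt (0 : ℝ) (hasDerivAt_rot_zero z)
    rwa [h0] at this
  rw [fderiv_const_mul hz.differentiableAt]
  simp only [smul_apply, smul_eq_mul]
  rw [hd2.unique hd1]
  field_simp

/-- Substituting in `∫₀ˢ M` extracts a factor `s`, leaving an average of dilates of `M`, analytic by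
`analyticAt_integral_comp_clm`. The quotient `J` is the squared radial factor of the twist map. -/
lemma exists_analyticAt_primitive_div {M : ℝ → ℝ} (hM : AnalyticAt ℝ M 0) :
    ∃ J : ℝ → ℝ, AnalyticAt ℝ J 0 ∧ J 0 = M 0 ∧
      ∀ᶠ s in 𝓝 0, HasDerivAt (fun s => s * J s) (M s) s := by
  let L : ℝ → ℝ →L[ℝ] ℝ := fun t => t • ContinuousLinearMap.id ℝ ℝ
  refine ⟨fun s => ∫ t in (0 : ℝ)..1, M (t * s), ?_, by simp, ?_⟩
  · simpa [L] using analyticAt_integral_comp_clm hM (L := L) (by fun_prop)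
      (w := fun _ => 1) continuous_const 0 1
  obtain ⟨ε, hε, h⟩ := Metric.eventually_nhds_iff_ball.1 hM.eventually_analyticAt
  filter_upwards [Metric.ball_mem_nhds _ hε] with s hs
  have heq : (fun s => s * ∫ t in (0 : ℝ)..1, M (t * s)) = fun s => ∫ t in (0 : ℝ)..s, M t := by
    funext s
    simp
  rw [heq]
  have hcont : ContinuousOn M (Metric.ball 0 ε) :=
    fun x hx => (h x hx).continuousAt.continuousWithinAt
  have hsub : Set.uIcc 0 s ⊆ Metric.ball (0 : ℝ) ε :=
    (convex_ball (0 : ℝ) ε).ordConnected.uIcc_subset (Metric.mem_ball_self hε) hs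
  refine intervalIntegral.integral_hasDerivAt_right (hcont.mono hsub).intervalIntegrable ?_
    (h s hs).continuousAt
  exact hcont.stronglyMeasurableAtFilter Metric.isOpen_ball s hs

/-! ### Twist maps and normalization of an area form -/

lemma det_clm_prod (L : ℝ × ℝ →L[ℝ] ℝ × ℝ) :
    L.det = (L (1, 0)).1 * (L (0, 1)).2 - (L (0, 1)).1 * (L (1, 0)).2 := by
  rw [ContinuousLinearMap.det, ← LinearMap.det_toMatrix (Module.Basis.finTwoProd ℝ),
    Matrix.det_fin_two]
  simp [LinearMap.toMatrix_apply]

/-- Half the squared Euclidean norm on the plane, the action of the harmonic oscillator. -/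
noncomputable def halfSq (z : ℝ × ℝ) : ℝ := (z.1 ^ 2 + z.2 ^ 2) / 2

lemma halfSq_zero : halfSq 0 = 0 := by simp [halfSq]

lemma halfSq_nonneg (z : ℝ × ℝ) : 0 ≤ halfSq z := by
  unfold halfSq
  positivity

@[fun_prop]
lemma analyticAt_halfSq (z : ℝ × ℝ) : AnalyticAt ℝ halfSq z := by
  unfold halfSq
  exact ((analyticAt_fst.pow 2).add (analyticAt_snd.pow 2)).div_const

@[fun_prop]
lemma continuous_halfSq : Continuous halfSq := by
  unfold halfSq
  fun_prop

lemma tendsto_halfSq : Tendsto halfSq (𝓝 0) (𝓝 0) := by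
  simpa [halfSq_zero] using continuous_halfSq.tendsto 0

lemma hasFDerivAt_halfSq (z : ℝ × ℝ) :
    HasFDerivAt halfSq (z.1 • ContinuousLinearMap.fst ℝ ℝ ℝ + z.2 • ContinuousLinearMap.snd ℝ ℝ ℝ)
      z := by
  have h1 : HasFDerivAt (Prod.fst : ℝ × ℝ → ℝ) (ContinuousLinearMap.fst ℝ ℝ ℝ) z := hasFDerivAt_fst
  have h2 : HasFDerivAt (Prod.snd : ℝ × ℝ → ℝ) (ContinuousLinearMap.snd ℝ ℝ ℝ) z := hasFDerivAt_snd
  have h := ((h1.pow 2).add (h2.pow 2)).mul_const (1 / 2 : ℝ)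
  refine (h.congr_of_eventuallyEq (Eventually.of_forall fun w => ?_)).congr_fderiv ?_
  · simp [halfSq]; ring
  · ext <;> simp

lemma analyticAt_sqrt {x : ℝ} (hx : x ≠ 0) : AnalyticAt ℝ Real.sqrt x :=
  (Real.contDiffAt_sqrt hx (n := ⊤)).analyticAt

/-- The Jacobian determinant of a twist map `z ↦ ρ(|z|²/2) e^{i g(z)} z`. -/
lemma det_fderiv_twist {g : ℝ × ℝ → ℝ} {ρ : ℝ → ℝ} {z : ℝ × ℝ} {ρ' : ℝ}
    (hg : DifferentiableAt ℝ g z) (hρ : HasDerivAt ρ ρ' (halfSq z)) :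
    (fderiv ℝ (fun z => ρ (halfSq z) • rot (g z) z) z).det =
      (1 + fderiv ℝ g z (-z.2, z.1)) *
        (ρ (halfSq z) ^ 2 + halfSq z * (2 * ρ (halfSq z) * ρ')) := by
  have h1 : HasFDerivAt (Prod.fst : ℝ × ℝ → ℝ) (ContinuousLinearMap.fst ℝ ℝ ℝ) z := hasFDerivAt_fst
  have h2 : HasFDerivAt (Prod.snd : ℝ × ℝ → ℝ) (ContinuousLinearMap.snd ℝ ℝ ℝ) z := hasFDerivAt_snd
  have hG := hg.hasFDerivAt
  set G := fderiv ℝ g z with hGdef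
  have hR := hρ.comp_hasFDerivAt z (hasFDerivAt_halfSq z)
  have hX := (hG.cos.mul h1).sub (hG.sin.mul h2)
  have hY := (hG.cos.mul h2).add (hG.sin.mul h1)
  have hZ := (hR.mul hX).prodMk (hR.mul hY)
  have heq : (fun z => ρ (halfSq z) • rot (g z) z) = fun z : ℝ × ℝ =>
      (ρ (halfSq z) * (Real.cos (g z) * z.1 - Real.sin (g z) * z.2),
        ρ (halfSq z) * (Real.cos (g z) * z.2 + Real.sin (g z) * z.1)) := by
    funext z
    simp [rot_apply]
  have hlin : G (-z.2, z.1) = z.1 * G (0, 1) - z.2 * G (1, 0) := by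
    rw [show ((-z.2, z.1) : ℝ × ℝ) = z.1 • (0, 1) - z.2 • (1, 0) by ext <;> simp, map_sub,
      map_smul, map_smul, smul_eq_mul, smul_eq_mul]
  rw [heq]
  refine (congrArg ContinuousLinearMap.det hZ.fderiv).trans ?_
  rw [det_clm_prod, hlin]
  have hcs := Real.sin_sq_add_cos_sq (g z)
  simp [halfSq]
  generalize G (1, 0) = gu at *
  generalize G (0, 1) = gv at *
  generalize ρ ((z.1 ^ 2 + z.2 ^ 2) / 2) = R at *
  generalize Real.cos (g z) = C at *
  generalize Real.sin (g z) = S at *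
  obtain ⟨u, v⟩ := z
  simp only
  have hS : S ^ 2 = 1 - C ^ 2 := by linarith
  grind

lemma halfSq_smul_rot (c t : ℝ) (z : ℝ × ℝ) : halfSq (c • rot t z) = c ^ 2 * halfSq z := by
  simp only [halfSq, rot_apply, Prod.smul_mk, smul_eq_mul]
  linear_combination (c ^ 2 * (z.1 ^ 2 + z.2 ^ 2) / 2) * Real.sin_sq_add_cos_sq t

/-- Simultaneous normalization, near the origin of the plane, of an area form `f dx ∧ dy` and of
the function `(x² + y²)/2`. -/
lemma exists_normalizing_map {f : ℝ × ℝ → ℝ} {M : ℝ → ℝ} (hf : AnalyticAt ℝ f 0)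
    (hM : AnalyticAt ℝ M 0) (hM0 : 0 < M 0)
    (hmean : ∀ᶠ z in 𝓝 0,
      (2 * Real.pi)⁻¹ * ∫ t in (0 : ℝ)..2 * Real.pi, f (rot t z) = M (halfSq z)) :
    ∃ (Z : ℝ × ℝ → ℝ × ℝ) (I : ℝ → ℝ), AnalyticAt ℝ Z 0 ∧ Z 0 = 0 ∧ AnalyticAt ℝ I 0 ∧ I 0 = 0 ∧
      (∀ᶠ s in 𝓝 0, HasDerivAt I (M s) s) ∧ (∀ᶠ z in 𝓝 0, halfSq (Z z) = I (halfSq z)) ∧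
      ∀ᶠ z in 𝓝 0, (fderiv ℝ Z z).det = f z := by
  have hMs : AnalyticAt ℝ (fun z => M (halfSq z)) 0 :=
    hM.comp_of_eq (analyticAt_halfSq 0) halfSq_zero
  have hM0' : M (halfSq 0) ≠ 0 := by rw [halfSq_zero]; exact hM0.ne'
  -- Dividing by `M` makes the mean on each circle equal to `1`, so the angular factor `1 + ∂g` of
  -- the Jacobian becomes `f / M`. With `ρ = √J` the radial factor is `J + s J' = (s J)' = M`, and
  -- the product is `f`.
  obtain ⟨g, hg, hgD⟩ := exists_analyticAt_angular_primitive (hf.div hMs hM0')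
  obtain ⟨J, hJ, hJ0, hJD⟩ := exists_analyticAt_primitive_div hM
  have hJpos : ∀ᶠ s in 𝓝 0, 0 < J s := hJ.continuousAt.eventually_const_lt (by rwa [hJ0])
  have hMne : ∀ᶠ s in 𝓝 0, M s ≠ 0 := hM.continuousAt.eventually_ne hM0.ne'
  have hρ : AnalyticAt ℝ (fun s => √(J s)) 0 :=
    (analyticAt_sqrt (by rw [hJ0]; exact hM0.ne')).comp_of_eq hJ rfl
  refine ⟨fun z => √(J (halfSq z)) • rot (g z) z, fun s => s * J s, ?_, by simp,
    analyticAt_id.mul hJ, by simp, hJD, ?_, ?_⟩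
  · have h1 : AnalyticAt ℝ (fun z => √(J (halfSq z))) 0 :=
      hρ.comp_of_eq (analyticAt_halfSq 0) halfSq_zero
    have hc : AnalyticAt ℝ (fun z => Real.cos (g z)) 0 := Real.analyticAt_cos.comp hg
    have hs : AnalyticAt ℝ (fun z => Real.sin (g z)) 0 := Real.analyticAt_sin.comp hg
    simp only [rot_apply]
    refine h1.smul ?_
    exact ((hc.mul analyticAt_fst).sub (hs.mul analyticAt_snd)).prod
      ((hc.mul analyticAt_snd).add (hs.mul analyticAt_fst))
  · filter_upwards [tendsto_halfSq.eventually hJpos] with z hz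
    rw [halfSq_smul_rot, Real.sq_sqrt hz.le, mul_comm]
  · filter_upwards [hgD, hg.eventually_analyticAt, tendsto_halfSq.eventually hJpos,
      tendsto_halfSq.eventually hMne, tendsto_halfSq.eventually hJD,
      tendsto_halfSq.eventually hJ.eventually_analyticAt, hmean] with z h1 h2 h3 h4 h5 h6 h7
    have hJd := h6.differentiableAt.hasDerivAt
    have hsqrt := hJd.sqrt h3.ne'
    rw [det_fderiv_twist h2.differentiableAt hsqrt, h1]
    have hconst : ∀ t, halfSq (rot t z) = halfSq z := fun t => by
      simpa using halfSq_smul_rot 1 t z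
    simp only [Pi.div_apply, hconst, intervalIntegral.integral_div]
    rw [← mul_div_assoc, h7, div_self h4]
    have h8 := h5.unique ((hasDerivAt_id (halfSq z)).mul hJd)
    have hne : √(J (halfSq z)) ≠ 0 := (Real.sqrt_pos.2 h3).ne'
    rw [Real.sq_sqrt h3.le, mul_div_cancel₀ _ (mul_ne_zero two_ne_zero hne)]
    simp only [id, one_mul] at h8
    rw [← h8]
    field_simp
    ring

/-! ### Local inverses and rigidity of radii -/

/-- The analytic inverse function theorem in the plane, at a fixed point. -/
lemma exists_analyticAt_inverse {T : ℝ × ℝ → ℝ × ℝ} (hT : AnalyticAt ℝ T 0) (hT0 : T 0 = 0)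
    (hdet : (fderiv ℝ T 0).det ≠ 0) :
    ∃ W : ℝ × ℝ → ℝ × ℝ, AnalyticAt ℝ W 0 ∧ W 0 = 0 ∧ (∀ᶠ z in 𝓝 0, T (W z) = z) ∧
      ∀ᶠ z in 𝓝 0, W (T z) = z := by
  have hc : ContDiffAt ℝ ⊤ T 0 := hT.contDiffAt
  have hd : HasFDerivAt T
      ((fderiv ℝ T 0).toContinuousLinearEquivOfDetNeZero hdet : ℝ × ℝ →L[ℝ] ℝ × ℝ) 0 := by
    rw [ContinuousLinearMap.coe_toContinuousLinearEquivOfDetNeZero]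
    exact hT.differentiableAt.hasFDerivAt
  have hs := hc.hasStrictFDerivAt' hd (by simp)
  refine ⟨hc.localInverse hd (by simp), ?_, ?_, ?_, hs.eventually_left_inverse⟩
  · simpa [hT0] using (hc.to_localInverse hd (by simp)).analyticAt
  · simpa [hT0] using hc.localInverse_apply_image hd (by simp)
  · have := hs.eventually_right_inverse
    rwa [hT0] at this

/-- The one-dimensional analytic inverse function theorem. -/
lemma exists_analyticAt_inverse_real {f : ℝ → ℝ} {x : ℝ} (hf : AnalyticAt ℝ f x)
    (hf' : deriv f x ≠ 0) :
    ∃ G : ℝ → ℝ, AnalyticAt ℝ G (f x) ∧ G (f x) = x ∧ (∀ᶠ t in 𝓝 (f x), f (G t) = t) ∧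
      ∀ᶠ s in 𝓝 x, G (f s) = s := by
  have hs := hf.hasStrictDerivAt
  have hs' := hs.hasStrictFDerivAt_equiv hf'
  exact ⟨_, hf.analyticAt_localInverse hf', hs'.localInverse_apply_image,
    hs'.eventually_right_inverse, hs'.eventually_left_inverse⟩

lemma exists_halfSq_lt_of_eventually {p : ℝ × ℝ → Prop} (hp : ∀ᶠ z in 𝓝 0, p z) :
    ∃ ε > 0, ∀ z, halfSq z < ε → p z := by
  obtain ⟨ε, hε, h⟩ := Metric.eventually_nhds_iff.1 hp
  refine ⟨ε ^ 2 / 2, by positivity, fun z hz => h ?_⟩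
  rw [halfSq] at hz
  rw [dist_zero_right, Prod.norm_def, max_lt_iff, Real.norm_eq_abs, Real.norm_eq_abs]
  exact ⟨abs_lt_of_sq_lt_sq (by nlinarith [sq_nonneg z.2]) hε.le,
    abs_lt_of_sq_lt_sq (by nlinarith [sq_nonneg z.1]) hε.le⟩

-- Dilation by `√t` scales plane area by `t`. The area of the unit sublevel set cancels later, so
-- its value is never needed.
open MeasureTheory Pointwise in
lemma volume_halfSq_le {t : ℝ} (ht : 0 < t) :
    volume {z | halfSq z ≤ t} = ENNReal.ofReal t * volume {z | halfSq z ≤ 1} := by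
  have h : {z | halfSq z ≤ t} = √t • {z | halfSq z ≤ 1} := by
    have hs : √t ≠ 0 := (Real.sqrt_pos.2 ht).ne'
    ext z
    rw [Set.mem_smul_set_iff_inv_smul_mem₀ hs]
    have hsq : (√t)⁻¹ ^ 2 = t⁻¹ := by rw [inv_pow, Real.sq_sqrt ht.le]
    have : halfSq ((√t)⁻¹ • z) = t⁻¹ * halfSq z := by
      simpa [rot_apply, hsq] using halfSq_smul_rot (√t)⁻¹ 0 z
    rw [Set.mem_ofPred_eq, Set.mem_ofPred_eq, this, inv_mul_le_iff₀ ht, mul_one]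
  rw [h, Measure.addHaar_smul]
  simp [Real.sq_sqrt ht.le, abs_of_pos ht]

open MeasureTheory in
/-- An area-preserving local map of the plane which maps circles to circles, with radii governed
by `χ`, preserves the radii. -/
lemma eventually_eq_of_abs_det_eq_one {T : ℝ × ℝ → ℝ × ℝ} (hT : AnalyticAt ℝ T 0) (hT0 : T 0 = 0)
    (hdet : ∀ᶠ z in 𝓝 0, |(fderiv ℝ T z).det| = 1) {χ : ℝ → ℝ} (hχ : AnalyticAt ℝ χ 0)
    (hχ0 : deriv χ 0 ≠ 0) (h : ∀ᶠ z in 𝓝 0, halfSq (T z) = χ (halfSq z)) :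
    ∀ᶠ t in 𝓝 0, χ t = t := by
  have hdet0 : (fderiv ℝ T 0).det ≠ 0 := by
    intro h0
    have := hdet.self_of_nhds
    rw [h0] at this
    norm_num at this
  obtain ⟨W, hW, hW0, hTW, hWT⟩ := exists_analyticAt_inverse hT hT0 hdet0
  have hχz : χ 0 = 0 := by
    have := h.self_of_nhds
    rw [hT0, halfSq_zero] at this
    exact this.symm
  obtain ⟨ε, hε, hball⟩ := exists_halfSq_lt_of_eventually
    (hdet.and (h.and (hWT.and (hT.eventually_analyticAt))))
  have hnonneg : ∀ t, 0 ≤ t → t < ε → 0 ≤ χ t := by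
    intro t ht htε
    have hz : halfSq (√(2 * t), 0) = t := by
      simp only [halfSq]
      rw [Real.sq_sqrt (by positivity)]
      ring
    have := (hball (√(2 * t), 0) (by rwa [hz])).2.1
    rw [hz] at this
    rw [← this]
    exact halfSq_nonneg _
  -- On `t ≥ 0` the values of `χ` are values of `halfSq`, hence nonnegative; this fixes the sign of
  -- the nonzero derivative.
  have hχpos : 0 < deriv χ 0 := by
    refine lt_of_le_of_ne ?_ hχ0.symm
    have hd : HasDerivWithinAt χ (deriv χ 0) (Set.Ioi 0) 0 :=
      hχ.differentiableAt.hasDerivAt.hasDerivWithinAt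
    rw [hasDerivWithinAt_iff_tendsto_slope' (by simp)] at hd
    refine ge_of_tendsto hd ?_
    filter_upwards [Ioo_mem_nhdsGT hε] with t ht
    rw [slope_def_field, hχz, sub_zero, sub_zero]
    exact div_nonneg (hnonneg t ht.1.le ht.2) ht.1.le
  have hdpos : ∀ᶠ t in 𝓝 0, 0 < deriv χ t ∧ ContinuousAt χ t :=
    (hχ.deriv.continuousAt.eventually_const_lt hχpos).and
      (hχ.eventually_analyticAt.mono fun t ht => ht.continuousAt)
  obtain ⟨δ, hδ, hδd⟩ := Metric.eventually_nhds_iff_ball.1 hdpos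
  have hmono : StrictMonoOn χ (Metric.ball 0 δ) := by
    refine strictMonoOn_of_deriv_pos (convex_ball 0 δ)
      (fun t ht => (hδd t ht).2.continuousWithinAt) fun t ht => (hδd t ?_).1
    rwa [Metric.isOpen_ball.interior_eq] at ht
  obtain ⟨η, hη, hηW⟩ := exists_halfSq_lt_of_eventually (hTW.and
    ((continuous_halfSq.continuousAt.comp hW.continuousAt).eventually_lt_const
      (u := min ε δ) (by simp [hW0, halfSq_zero, hε, hδ])))
  have hχη : ∀ᶠ t in 𝓝 0, χ t < η := hχ.continuousAt.eventually_lt_const (by rwa [hχz])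
  -- Circles exist only for `t > 0`; the identity theorem carries the equality to both sides of `0`.
  refine (hχ.frequently_eq_iff_eventually_eq analyticAt_id).1 ?_
  refine Frequently.filter_mono (f := 𝓝[>] 0) ?_ (nhdsWithin_mono _ fun t ht => ne_of_gt ht)
  refine Eventually.frequently ?_
  filter_upwards [Ioo_mem_nhdsGT (lt_min hε hδ), nhdsWithin_le_nhds hχη] with t ht htη
  have htpos := ht.1
  have htε : t < ε := ht.2.trans_le (min_le_left _ _)
  have htδ : t < δ := ht.2.trans_le (min_le_right _ _)
  have hmem : ∀ s, 0 ≤ s → s < δ → s ∈ Metric.ball (0 : ℝ) δ := by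
    intro s hs hsδ
    rwa [Metric.mem_ball, dist_zero_right, Real.norm_of_nonneg hs]
  have hχt : 0 < χ t := by
    rw [← hχz]
    exact hmono (Metric.mem_ball_self hδ) (hmem t htpos.le htδ) htpos
  -- Discs go onto discs: monotonicity of `χ` gives one inclusion, and with the local inverse `W`
  -- the other.
  have himage : T '' {z | halfSq z ≤ t} = {z | halfSq z ≤ χ t} := by
    refine Set.Subset.antisymm ?_ fun w hw => ?_
    · rintro _ ⟨z, hz, rfl⟩
      have hz' : halfSq z ≤ t := hz
      rw [Set.mem_ofPred_eq, (hball z (hz'.trans_lt htε)).2.1]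
      exact hmono.monotoneOn (hmem _ (halfSq_nonneg z) (hz'.trans_lt htδ))
        (hmem t htpos.le htδ) hz'
    · have hw' : halfSq w ≤ χ t := hw
      obtain ⟨h1, h2⟩ := hηW w (hw'.trans_lt htη)
      have h2' : halfSq (W w) < min ε δ := h2
      refine ⟨W w, ?_, h1⟩
      have h3 := (hball (W w) (h2'.trans_le (min_le_left _ _))).2.1
      rw [h1] at h3
      rw [h3] at hw'
      exact (hmono.le_iff_le (hmem _ (halfSq_nonneg _) (h2'.trans_le (min_le_right _ _)))
        (hmem t htpos.le htδ)).1 hw'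
  have hmeas : MeasurableSet {z | halfSq z ≤ t} :=
    (isClosed_le continuous_halfSq continuous_const).measurableSet
  have harea := lintegral_abs_det_fderiv_eq_addHaar_image volume hmeas (f := T)
    (f' := fun z => fderiv ℝ T z)
    (fun z hz =>
      (hball z (lt_of_le_of_lt hz htε)).2.2.2.differentiableAt.hasFDerivAt.hasFDerivWithinAt)
    (Set.LeftInvOn.injOn (f₁' := W) fun z hz => (hball z (lt_of_le_of_lt hz htε)).2.2.1)
  rw [himage, setLIntegral_congr_fun hmeas (g := fun _ => 1)
    (fun z hz => by simp only [(hball z (lt_of_le_of_lt hz htε)).1, ENNReal.ofReal_one]),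
    setLIntegral_const, one_mul, volume_halfSq_le htpos, volume_halfSq_le hχt] at harea
  have hV0 : volume {z | halfSq z ≤ 1} ≠ 0 := by
    have hopen : IsOpen {z | halfSq z < 1} := isOpen_lt continuous_halfSq continuous_const
    have hpos : 0 < volume {z | halfSq z < 1} :=
      hopen.measure_pos volume (Set.nonempty_of_mem (x := 0) (by simp [halfSq_zero]))
    exact (hpos.trans_le (measure_mono fun z (hz : halfSq z < 1) => hz.le)).ne'
  have hVtop : volume {z | halfSq z ≤ 1} ≠ ⊤ := by
    refine ((measure_mono (t := Metric.closedBall 0 2) fun z (hz : halfSq z ≤ 1) => ?_).trans_lt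
      (isCompact_closedBall (0 : ℝ × ℝ) 2).measure_lt_top).ne
    rw [halfSq] at hz
    rw [mem_closedBall_zero_iff, Prod.norm_def, max_le_iff, Real.norm_eq_abs, Real.norm_eq_abs]
    exact ⟨abs_le_of_sq_le_sq (by nlinarith [sq_nonneg z.2]) zero_le_two,
      abs_le_of_sq_le_sq (by nlinarith [sq_nonneg z.1]) zero_le_two⟩
  rw [ENNReal.mul_left_inj hV0 hVtop, ENNReal.ofReal_eq_ofReal_iff htpos.le hχt.le] at harea
  exact harea.symm

/-! ### The elliptic integral in trigonometric form -/

/-- Substitute `x = sin t`. On the open interval `cos t > 0`, so the Jacobian cancels `√(1 - x²)`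
and the singular endpoint is avoided. -/
lemma integral_one_div_sqrt_sin_eq_ellipticK (lam : ℝ) :
    ∫ t in (0 : ℝ)..Real.pi / 2, 1 / √(1 - lam * Real.sin t ^ 2) = ellipticK lam := by
  have hpi := Real.pi_pos
  have hcos : ∀ t ∈ Set.Ioo 0 (Real.pi / 2), 0 < Real.cos t := fun t ht =>
    Real.cos_pos_of_mem_Ioo ⟨by linarith [ht.1], ht.2⟩
  have hinj : Set.InjOn Real.sin (Set.Ioo 0 (Real.pi / 2)) :=
    Real.injOn_sin.mono fun t (ht : t ∈ Set.Ioo 0 (Real.pi / 2)) =>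
      Set.mem_Icc.2 ⟨by linarith [ht.1], ht.2.le⟩
  have himage : Real.sin '' Set.Ioo 0 (Real.pi / 2) = Set.Ioo 0 1 := by
    refine Set.Subset.antisymm ?_ fun x hx => ?_
    · rintro _ ⟨t, ht, rfl⟩
      refine ⟨Real.sin_pos_of_pos_of_lt_pi ht.1 (by linarith [ht.2]), ?_⟩
      have := Real.sin_sq_add_cos_sq t
      nlinarith [hcos t ht, pow_pos (hcos t ht) 2]
    · exact ⟨Real.arcsin x, ⟨Real.arcsin_pos.2 hx.1, Real.arcsin_lt_pi_div_two.2 hx.2⟩,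
        Real.sin_arcsin (by linarith [hx.1]) hx.2.le⟩
  rw [ellipticK, intervalIntegral.integral_of_le (by positivity),
    intervalIntegral.integral_of_le zero_le_one, MeasureTheory.integral_Ioc_eq_integral_Ioo,
    MeasureTheory.integral_Ioc_eq_integral_Ioo, ← himage,
    MeasureTheory.integral_image_eq_integral_abs_deriv_smul measurableSet_Ioo
      (fun t _ => (Real.hasDerivAt_sin t).hasDerivWithinAt) hinj]
  refine MeasureTheory.setIntegral_congr_fun measurableSet_Ioo fun t ht => ?_
  have hc := hcos t ht
  simp only [smul_eq_mul]
  rw [← Real.cos_sq', Real.sqrt_mul (sq_nonneg _), Real.sqrt_sq hc.le, abs_of_pos hc]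
  field_simp

lemma integral_one_div_sqrt_cos_eq_ellipticK {lam : ℝ} (hlam : lam < 1) :
    ∫ t in (0 : ℝ)..2 * Real.pi, 1 / √(1 - lam * Real.cos t ^ 2) = 4 * ellipticK lam := by
  have hcont : Continuous fun t => 1 / √(1 - lam * Real.cos t ^ 2) := by
    refine continuous_const.div (by fun_prop) fun t => (Real.sqrt_pos.2 ?_).ne'
    rcases le_or_gt lam 0 with h0 | h0
    · nlinarith [sq_nonneg (Real.cos t)]
    · nlinarith [Real.cos_sq_le_one t]
  have hint : ∀ a b, IntervalIntegrable (fun t => 1 / √(1 - lam * Real.cos t ^ 2))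
      MeasureTheory.volume a b := fun a b => hcont.intervalIntegrable a b
  have h1 : ∫ t in (0 : ℝ)..Real.pi / 2, 1 / √(1 - lam * Real.cos t ^ 2) = ellipticK lam := by
    rw [← integral_one_div_sqrt_sin_eq_ellipticK]
    have := intervalIntegral.integral_comp_sub_left (a := 0) (b := Real.pi / 2)
      (fun t => 1 / √(1 - lam * Real.cos t ^ 2)) (Real.pi / 2)
    simpa [Real.cos_pi_div_two_sub] using this.symm
  have h2 : ∫ t in (Real.pi / 2)..Real.pi, 1 / √(1 - lam * Real.cos t ^ 2) = ellipticK lam := by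
    rw [← integral_one_div_sqrt_sin_eq_ellipticK]
    have := intervalIntegral.integral_comp_add_right (a := 0) (b := Real.pi / 2)
      (fun t => 1 / √(1 - lam * Real.cos t ^ 2)) (Real.pi / 2)
    simpa [Real.cos_add_pi_div_two] using this.symm
  have h3 : ∫ t in (0 : ℝ)..Real.pi, 1 / √(1 - lam * Real.cos t ^ 2) = 2 * ellipticK lam := by
    rw [← intervalIntegral.integral_add_adjacent_intervals (hint 0 (Real.pi / 2)) (hint _ _), h1,
      h2]
    ring
  have h4 : ∫ t in Real.pi..2 * Real.pi, 1 / √(1 - lam * Real.cos t ^ 2) = 2 * ellipticK lam := by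
    rw [← h3]
    have := intervalIntegral.integral_comp_add_right (a := 0) (b := Real.pi)
      (fun t => 1 / √(1 - lam * Real.cos t ^ 2)) Real.pi
    simpa [Real.cos_add_pi, two_mul] using this.symm
  rw [← intervalIntegral.integral_add_adjacent_intervals (hint 0 Real.pi) (hint _ _), h3, h4]
  ring

/-! ### The rigid body in rescaled coordinates -/

/-- Half the squared norm of `(p₂, p₃)` in the rescaled coordinates `(√A p₂, √B p₃)`. -/
noncomputable def quad (A B : ℝ) (z : ℝ × ℝ) : ℝ := (z.1 ^ 2 / A + z.2 ^ 2 / B) / 2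

/-- The density of the symplectic form in the rescaled coordinates, as a function of `quad`. -/
noncomputable def density (A B l w : ℝ) : ℝ := 1 / (3 * √(A * B) * √(2 * l - 2 * w))

/-- The average of the symplectic density over the circle with `halfSq = s`. -/
noncomputable def meanDensity (A B l s : ℝ) : ℝ :=
  (2 * Real.pi)⁻¹ * ∫ t in (0 : ℝ)..2 * Real.pi,
    density A B l ((Real.cos t ^ 2 / A + Real.sin t ^ 2 / B) * s)

/-- The rescaled projection `P ↦ (√A p₂, √B p₃)`. -/
noncomputable def proj (A B : ℝ) : (Fin 3 → ℝ) →L[ℝ] ℝ × ℝ :=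
  (√A • ContinuousLinearMap.proj 1).prod (√B • ContinuousLinearMap.proj 2)

/-- The parametrization of a hemisphere `casimir = l` inverse to `proj`. -/
noncomputable def lift (A B l σ : ℝ) (z : ℝ × ℝ) : Fin 3 → ℝ :=
  ![σ * √(2 * l - 2 * quad A B z), z.1 / √A, z.2 / √B]

lemma proj_apply (A B : ℝ) (P : Fin 3 → ℝ) : proj A B P = (√A * P 1, √B * P 2) := rfl

lemma analyticAt_quad (A B : ℝ) (z : ℝ × ℝ) : AnalyticAt ℝ (quad A B) z := by
  unfold quad
  exact ((analyticAt_fst.pow 2).div_const.add (analyticAt_snd.pow 2).div_const).div_const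

lemma quad_zero (A B : ℝ) : quad A B 0 = 0 := by simp [quad]

section
variable {A B l : ℝ}

lemma analyticAt_density (hA : 0 < A) (hB : 0 < B) (hl : 0 < l) :
    AnalyticAt ℝ (density A B l) 0 := by
  unfold density
  have h1 : AnalyticAt ℝ (fun w : ℝ => 2 * l - 2 * w) 0 := by fun_prop
  have h2 : AnalyticAt ℝ (fun w : ℝ => √(2 * l - 2 * w)) 0 :=
    (analyticAt_sqrt (x := 2 * l - 2 * 0) (by linarith)).comp_of_eq h1 rfl
  refine analyticAt_const.div (analyticAt_const.mul h2) ?_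
  have : 0 < 2 * l - 2 * 0 := by linarith
  positivity

lemma analyticAt_meanDensity (hA : 0 < A) (hB : 0 < B) (hl : 0 < l) :
    AnalyticAt ℝ (meanDensity A B l) 0 := by
  let L : ℝ → ℝ →L[ℝ] ℝ := fun t =>
    (Real.cos t ^ 2 / A + Real.sin t ^ 2 / B) • ContinuousLinearMap.id ℝ ℝ
  have h := analyticAt_integral_comp_clm (analyticAt_density hA hB hl) (L := L) (by fun_prop)
    (w := fun _ => (2 * Real.pi)⁻¹) continuous_const 0 (2 * Real.pi)
  rw [show meanDensity A B l = _ from funext fun s => meanDensity.eq_1 A B l s]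
  simpa [L] using h

lemma meanDensity_zero_pos (hA : 0 < A) (hB : 0 < B) (hl : 0 < l) : 0 < meanDensity A B l 0 := by
  have hpi := Real.pi_pos
  have : 0 < density A B l 0 := by
    rw [density, mul_zero, sub_zero]
    positivity
  simp only [meanDensity, mul_zero, intervalIntegral.integral_const, sub_zero, smul_eq_mul]
  positivity

/-- In polar coordinates a rotation shifts the argument of a `2π`-periodic integrand, so the mean
depends on the radius alone. -/
lemma integral_density_rot (A B l : ℝ) (z : ℝ × ℝ) :
    (2 * Real.pi)⁻¹ * ∫ t in (0 : ℝ)..2 * Real.pi, density A B l (quad A B (rot t z)) =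
      meanDensity A B l (halfSq z) := by
  obtain ⟨r, θ, rfl⟩ : ∃ r θ : ℝ, z = (r * Real.cos θ, r * Real.sin θ) := by
    let w : ℂ := ⟨z.1, z.2⟩
    exact ⟨‖w‖, w.arg, Prod.ext (Complex.norm_mul_cos_arg w).symm
      (Complex.norm_mul_sin_arg w).symm⟩
  have hs : halfSq (r * Real.cos θ, r * Real.sin θ) = r ^ 2 / 2 := by
    simp only [halfSq]
    linear_combination (r ^ 2 / 2) * Real.sin_sq_add_cos_sq θ
  let h : ℝ → ℝ := fun t =>
    density A B l ((Real.cos t ^ 2 / A + Real.sin t ^ 2 / B) * (r ^ 2 / 2))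
  have hper : Function.Periodic h (2 * Real.pi) := fun t => by simp [h]
  have hrot : ∀ t, density A B l (quad A B (rot t (r * Real.cos θ, r * Real.sin θ))) =
      h (t + θ) := by
    intro t
    simp only [h, rot_apply, quad, Real.cos_add, Real.sin_add]
    congr 1
    ring
  rw [hs, meanDensity]
  simp only [hrot]
  rw [intervalIntegral.integral_comp_add_right h, zero_add, add_comm (2 * Real.pi) θ,
    hper.intervalIntegral_add_eq θ 0, zero_add]

/-- With `h = d l`, the product of the two radicands in the density factors as `2l (a - b)(d - c)(1
- λ cos² t)`. The condition `b l < h` is what gives `λ < 1`. -/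
lemma meanDensity_eq_neg_periodS {a b c h : ℝ} (hl : 0 < l) (hba : b < a) (hcb : c < b)
    (hh : b * l < h) :
    meanDensity (a - b) (a - c) l (l * a - h) = -periodS l a b c (h / l) := by
  have hpi := Real.pi_pos
  obtain ⟨d, rfl⟩ : ∃ d, h = d * l := ⟨h / l, by field_simp⟩
  have hbd : b < d := lt_of_mul_lt_mul_right hh hl.le
  rw [mul_div_cancel_right₀ _ hl.ne']
  have hA : 0 < a - b := by linarith
  have hB : 0 < a - c := by linarith
  have hdc : 0 < d - c := by linarith
  set lam := (d - a) * (b - c) / ((d - c) * (b - a)) with hlam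
  have hlam' : 1 - lam = (d - b) * (a - c) / ((a - b) * (d - c)) := by
    have : b - a ≠ 0 := by linarith
    rw [hlam]
    field_simp
    ring
  have hlam1 : lam < 1 := by
    have : 0 < (d - b) * (a - c) / ((a - b) * (d - c)) := by
      have : 0 < d - b := by linarith
      positivity
    linarith
  have hd : ∀ t, density (a - b) (a - c) l
      ((Real.cos t ^ 2 / (a - b) + Real.sin t ^ 2 / (a - c)) * (l * a - d * l)) =
      1 / (3 * √(a - b) * √(2 * l) * √(d - c)) * (1 / √(1 - lam * Real.cos t ^ 2)) := by
    intro t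
    have h1 : (a - b) * (a - c) * (2 * l - 2 * ((Real.cos t ^ 2 / (a - b) +
        Real.sin t ^ 2 / (a - c)) * (l * a - d * l))) =
        (a - b) * (2 * l) * (d - c) * (1 - lam * Real.cos t ^ 2) := by
      have : lam = 1 - (d - b) * (a - c) / ((a - b) * (d - c)) := by linarith
      rw [this, Real.sin_sq]
      field_simp
      ring
    rw [density, mul_assoc, ← Real.sqrt_mul (by positivity), h1, Real.sqrt_mul (by positivity),
      Real.sqrt_mul (by positivity), Real.sqrt_mul (by positivity), div_mul_div_comm, one_mul]
    ring_nf
  rw [meanDensity]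
  simp only [hd]
  rw [intervalIntegral.integral_const_mul, integral_one_div_sqrt_cos_eq_ellipticK hlam1, periodS,
    ← hlam, Real.sqrt_div zero_le_two, Real.sqrt_mul zero_le_two, Real.sqrt_mul hdc.le]
  have h2 : √2 ^ 2 = 2 := Real.sq_sqrt zero_le_two
  have h2' : √2 ≠ 0 := by positivity
  have hl' : √l ≠ 0 := by positivity
  have hA' : √(a - b) ≠ 0 := by positivity
  have hdc' : √(d - c) ≠ 0 := by positivity
  field_simp
  rw [h2]
  ring

lemma halfSq_proj (hA : 0 ≤ A) (hB : 0 ≤ B) (P : Fin 3 → ℝ) :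
    halfSq (proj A B P) = (A * P 1 ^ 2 + B * P 2 ^ 2) / 2 := by
  simp only [halfSq, proj_apply, mul_pow, Real.sq_sqrt hA, Real.sq_sqrt hB]

lemma quad_proj (hA : 0 < A) (hB : 0 < B) (P : Fin 3 → ℝ) :
    quad A B (proj A B P) = (P 1 ^ 2 + P 2 ^ 2) / 2 := by
  simp only [quad, proj_apply, mul_pow, Real.sq_sqrt hA.le, Real.sq_sqrt hB.le]
  field_simp

/-- The Casimir eliminates `p₁²`, leaving a nonnegative quadratic form in `p₂, p₃` that the
square-root rescaling makes round. -/
lemma energy_eq {I₁ I₂ I₃ : ℝ} (hA : 0 ≤ 1 / I₁ - 1 / I₂) (hB : 0 ≤ 1 / I₁ - 1 / I₃)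
    {P : Fin 3 → ℝ} (hP : casimir P = l) :
    energy I₁ I₂ I₃ P = l / I₁ - halfSq (proj (1 / I₁ - 1 / I₂) (1 / I₁ - 1 / I₃) P) := by
  rw [halfSq_proj hA hB, energy, ← hP, casimir]
  ring

lemma density_quad_proj (hA : 0 < A) (hB : 0 < B) {σ : ℝ} (hσ : σ ^ 2 = 1) {P : Fin 3 → ℝ}
    (hP : casimir P = l) (hP0 : 0 < σ * P 0) :
    density A B l (quad A B (proj A B P)) = 1 / (3 * √(A * B) * (σ * P 0)) := by
  have h : 2 * l - 2 * quad A B (proj A B P) = (σ * P 0) ^ 2 := by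
    rw [quad_proj hA hB, ← hP, casimir, mul_pow, hσ]
    ring
  rw [density, h, Real.sqrt_sq hP0.le]

/-- In the rescaled coordinates the symplectic form is `σ · density · dx ∧ dy`. -/
lemma orbitForm_fderiv_eq (hA : 0 < A) (hB : 0 < B) {σ : ℝ} (hσ : σ ^ 2 = 1)
    {ψ : ℝ × ℝ → Fin 3 → ℝ} {z : ℝ × ℝ} (hψ : DifferentiableAt ℝ ψ z)
    (hcas : ∀ᶠ w in 𝓝 z, casimir (ψ w) = l) (hpos : 0 < σ * ψ z 0) :
    orbitForm (ψ z) (fderiv ℝ ψ z (1, 0)) (fderiv ℝ ψ z (0, 1)) =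
      σ * (density A B l (quad A B (proj A B (ψ z))) *
        (fderiv ℝ (fun w => proj A B (ψ w)) z).det) := by
  have hd := hψ.hasFDerivAt
  have hcomp := hasFDerivAt_pi'.1 hd
  -- Differentiating the constant Casimir shows that the image of the derivative is tangent to the
  -- sphere, as `orbitForm_eq₁` requires.
  have htan : ∀ v, ψ z ⬝ᵥ fderiv ℝ ψ z v = 0 := by
    intro v
    have h1 := ((((hcomp 0).pow 2).add ((hcomp 1).pow 2)).add ((hcomp 2).pow 2)).mul_const
      (1 / 2 : ℝ)
    have h2 : HasFDerivAt (fun w => casimir (ψ w)) (0 : ℝ × ℝ →L[ℝ] ℝ) z :=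
      (hasFDerivAt_const l z).congr_of_eventuallyEq hcas
    have h3 := (h1.congr_of_eventuallyEq (f₁ := fun w => casimir (ψ w))
      (Eventually.of_forall fun w => by simp [casimir]; ring)).unique h2
    have h4 := congrArg (fun L : ℝ × ℝ →L[ℝ] ℝ => L v) h3
    simp at h4
    rw [dotProduct, Fin.sum_univ_three]
    linarith
  have h0 : ψ z 0 ≠ 0 := fun h => by simp [h] at hpos
  have hσ0 : σ ≠ 0 := fun h => by simp [h] at hσ
  have hAB : √(A * B) ≠ 0 := by positivity
  have hA' : √A ≠ 0 := by positivity
  have hB' : √B ≠ 0 := by positivity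
  rw [orbitForm_eq₁ _ _ _ (htan _) (htan _) h0, density_quad_proj hA hB hσ hcas.self_of_nhds hpos,
    HasFDerivAt.fderiv (f := fun w => proj A B (ψ w)) ((proj A B).hasFDerivAt.comp z hd),
    det_clm_prod]
  simp only [ContinuousLinearMap.comp_apply, proj_apply]
  rw [Real.sqrt_mul hA.le]
  field_simp

lemma proj_lift (hA : 0 < A) (hB : 0 < B) (l σ : ℝ) (z : ℝ × ℝ) :
    proj A B (lift A B l σ z) = z := by
  have hA' : √A ≠ 0 := by positivity
  have hB' : √B ≠ 0 := by positivity
  ext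
  · simp [proj_apply, lift]
    field_simp
  · simp [proj_apply, lift]
    field_simp

lemma casimir_lift (hA : 0 < A) (hB : 0 < B) {σ : ℝ} (hσ : σ ^ 2 = 1) {z : ℝ × ℝ}
    (hz : 0 ≤ 2 * l - 2 * quad A B z) : casimir (lift A B l σ z) = l := by
  have h : casimir (lift A B l σ z) =
      (σ ^ 2 * √(2 * l - 2 * quad A B z) ^ 2 + z.1 ^ 2 / √A ^ 2 + z.2 ^ 2 / √B ^ 2) / 2 := by
    simp [casimir, lift, mul_pow, div_pow]
  rw [h, hσ, Real.sq_sqrt hz, Real.sq_sqrt hA.le, Real.sq_sqrt hB.le, quad]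
  ring

lemma analyticAt_lift (A B : ℝ) (hl : 0 < l) (σ : ℝ) : AnalyticAt ℝ (lift A B l σ) 0 := by
  have h1 : AnalyticAt ℝ (fun z => 2 * l - 2 * quad A B z) 0 :=
    analyticAt_const.sub (analyticAt_const.mul (analyticAt_quad A B 0))
  have h2 : AnalyticAt ℝ (fun z => √(2 * l - 2 * quad A B z)) 0 :=
    (analyticAt_sqrt (x := 2 * l - 2 * quad A B 0) (by rw [quad_zero]; linarith)).comp_of_eq h1 rfl
  refine AnalyticAt.pi fun i => ?_
  fin_cases i
  · exact analyticAt_const.mul h2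
  · exact analyticAt_fst.div_const
  · exact analyticAt_snd.div_const

end

/-! ### Uniqueness and existence of the Birkhoff normal form -/

section
variable {A B l E₀ σ : ℝ} {H : (Fin 3 → ℝ) → ℝ}

/-- A map normalizing the symplectic density together with `halfSq`, and the action `I` as a
function of `halfSq`. -/
structure IsNormalizing (A B l : ℝ) (Z : ℝ × ℝ → ℝ × ℝ) (I : ℝ → ℝ) : Prop where
  analyticAt : AnalyticAt ℝ Z 0
  map_zero : Z 0 = 0
  analyticAt_action : AnalyticAt ℝ I 0
  action_zero : I 0 = 0
  hasDerivAt_action : ∀ᶠ s in 𝓝 0, HasDerivAt I (meanDensity A B l s) s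
  halfSq_map : ∀ᶠ z in 𝓝 0, halfSq (Z z) = I (halfSq z)
  det_fderiv : ∀ᶠ z in 𝓝 0, (fderiv ℝ Z z).det = density A B l (quad A B z)

lemma exists_isNormalizing (hA : 0 < A) (hB : 0 < B) (hl : 0 < l) :
    ∃ Z I, IsNormalizing A B l Z I := by
  obtain ⟨Z, I, h1, h2, h3, h4, h5, h6, h7⟩ := exists_normalizing_map
    (f := fun z => density A B l (quad A B z)) (M := meanDensity A B l)
    ((analyticAt_density hA hB hl).comp_of_eq (analyticAt_quad A B 0) (quad_zero A B))
    (analyticAt_meanDensity hA hB hl) (meanDensity_zero_pos hA hB hl)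
    (Eventually.of_forall (integral_density_rot A B l))
  exact ⟨Z, I, h1, h2, h3, h4, h5, h6, h7⟩

lemma IsNormalizing.deriv_action_ne_zero {Z : ℝ × ℝ → ℝ × ℝ} {I : ℝ → ℝ}
    (hZ : IsNormalizing A B l Z I) (hA : 0 < A) (hB : 0 < B) (hl : 0 < l) : deriv I 0 ≠ 0 := by
  rw [hZ.hasDerivAt_action.self_of_nhds.deriv]
  exact (meanDensity_zero_pos hA hB hl).ne'

/-- Any Birkhoff normal form is inverse to the action. -/
lemma IsNormalizing.action_sub_eq {Z : ℝ × ℝ → ℝ × ℝ} {I N : ℝ → ℝ} {P₀ : Fin 3 → ℝ}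
    (hZ : IsNormalizing A B l Z I) (hA : 0 < A) (hB : 0 < B) (hl : 0 < l) (hσ : σ ^ 2 = 1)
    (hH : ∀ P, casimir P = l → H P = E₀ - halfSq (proj A B P))
    (hP₀ : P₀ = ![σ * √(2 * l), 0, 0]) (hN : IsBirkhoffNormalForm l H P₀ N) :
    N 0 = E₀ ∧ ∀ᶠ t in 𝓝 0, I (E₀ - N t) = t := by
  obtain ⟨ψ, hψ, hNψ⟩ := hN.exists_chart
  have hQ0 : proj A B (ψ 0) = 0 := by
    rw [hψ.map_zero, hP₀, proj_apply]
    simp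
  have hQ : AnalyticAt ℝ (fun z => proj A B (ψ z)) 0 :=
    ((proj A B).analyticAt (ψ 0)).comp hψ.analyticAt
  have hQt : Tendsto (fun z => proj A B (ψ z)) (𝓝 0) (𝓝 0) := by
    have := hQ.continuousAt.tendsto
    rwa [hQ0] at this
  have hN0 : N 0 = E₀ := by
    have h1 := hNψ.self_of_nhds
    rw [hH _ hψ.mem_orbit.self_of_nhds, hQ0, halfSq_zero] at h1
    simpa using h1.symm
  have hpos : ∀ᶠ z in 𝓝 0, 0 < σ * ψ z 0 := by
    have hc : ContinuousAt (fun z => σ * ψ z 0) 0 :=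
      continuousAt_const.mul ((continuous_apply 0).continuousAt.comp hψ.analyticAt.continuousAt)
    refine hc.eventually_const_lt ?_
    change 0 < σ * ψ 0 0
    rw [hψ.map_zero, hP₀]
    have : σ * (σ * √(2 * l)) = √(2 * l) := by
      rw [← mul_assoc, ← sq, hσ, one_mul]
    rw [Matrix.cons_val_zero, this]
    positivity
  have hσabs : |σ| = 1 := by
    rw [← abs_one, ← sq_eq_sq_iff_abs_eq_abs, hσ, one_pow]
  -- The map from the Darboux chart to the normalized plane has Jacobian `σ`, so it may reverse
  -- orientation; only the absolute value matters for areas.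
  refine ⟨hN0, eventually_eq_of_abs_det_eq_one (T := fun z => Z (proj A B (ψ z))) ?_ ?_ ?_
    (χ := fun t => I (E₀ - N t)) ?_ ?_ ?_⟩
  · exact hZ.analyticAt.comp_of_eq hQ hQ0
  · rw [hQ0, hZ.map_zero]
  · filter_upwards [hQt.eventually hZ.det_fderiv,
      hQt.eventually hZ.analyticAt.eventually_analyticAt, hQ.eventually_analyticAt,
      hψ.analyticAt.eventually_analyticAt, hψ.mem_orbit.eventually_nhds, hψ.pullback_form, hpos]
      with z h1 h2 h3 h4 h5 h6 h7
    rw [orbitForm_fderiv_eq hA hB hσ h4.differentiableAt h5 h7, ← h1] at h6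
    have hcomp : fderiv ℝ (fun z => Z (proj A B (ψ z))) z =
        (fderiv ℝ Z (proj A B (ψ z))).comp (fderiv ℝ (fun z => proj A B (ψ z)) z) :=
      fderiv_comp z h2.differentiableAt h3.differentiableAt
    have hdet : (fderiv ℝ (fun z => Z (proj A B (ψ z))) z).det =
        (fderiv ℝ Z (proj A B (ψ z))).det * (fderiv ℝ (fun z => proj A B (ψ z)) z).det := by
      rw [hcomp]
      exact LinearMap.det_comp _ _
    rw [← hdet] at h6
    have := congrArg abs h6
    rwa [abs_mul, hσabs, one_mul, abs_one] at this
  · exact hZ.analyticAt_action.comp_of_eq (analyticAt_const.sub hN.analyticAt) (by simp [hN0])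
  · have h1 : HasDerivAt I (deriv I 0) (E₀ - N 0) := by
      rw [hN0, sub_self]
      exact hZ.analyticAt_action.differentiableAt.hasDerivAt
    have h2 := h1.comp 0 (hN.analyticAt.differentiableAt.hasDerivAt.const_sub E₀)
    have h3 : deriv (fun t => I (E₀ - N t)) 0 = deriv I 0 * -deriv N 0 := h2.deriv
    rw [h3]
    exact mul_ne_zero (hZ.deriv_action_ne_zero hA hB hl) (neg_ne_zero.2 hN.deriv_ne_zero)
  · filter_upwards [hQt.eventually hZ.halfSq_map, hψ.mem_orbit, hNψ] with z h1 h2 h3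
    rw [hH _ h2] at h3
    change _ = N (halfSq z) at h3
    rw [h1, ← h3, sub_sub_cancel]

/-- Any inverse Birkhoff normal form is the action, as a function of the energy. -/
lemma IsNormalizing.hasDerivAt_of_isInverseBirkhoffNormalForm {Z : ℝ × ℝ → ℝ × ℝ}
    {I Φ : ℝ → ℝ} {P₀ : Fin 3 → ℝ} (hZ : IsNormalizing A B l Z I) (hA : 0 < A) (hB : 0 < B)
    (hl : 0 < l) (hσ : σ ^ 2 = 1) (hH : ∀ P, casimir P = l → H P = E₀ - halfSq (proj A B P))
    (hP₀ : P₀ = ![σ * √(2 * l), 0, 0]) (hΦ : IsInverseBirkhoffNormalForm l H P₀ Φ) :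
    ∀ᶠ h in 𝓝 E₀, HasDerivAt Φ (-meanDensity A B l (E₀ - h)) h := by
  obtain ⟨N, hN, hΦN, -⟩ := hΦ
  obtain ⟨hN0, hI⟩ := hZ.action_sub_eq hA hB hl hσ hH hP₀ hN
  -- Since `N` is a local homeomorphism, every energy near `E₀` is some `N t` with `t` near `0`;
  -- negative `t` covers the energies not attained near `P₀`.
  have hmap : map N (𝓝 0) = 𝓝 E₀ := by
    rw [← hN0]
    exact hN.analyticAt.hasStrictDerivAt.map_nhds_eq hN.deriv_ne_zero
  have hΦI : ∀ᶠ h in 𝓝 E₀, Φ h = I (E₀ - h) := by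
    rw [← hmap, eventually_map]
    filter_upwards [hΦN, hI] with t h1 h2
    rw [h1, h2]
  have hsub : Tendsto (fun h => E₀ - h) (𝓝 E₀) (𝓝 0) := by
    simpa using (by fun_prop : Continuous fun h : ℝ => E₀ - h).tendsto E₀
  filter_upwards [hΦI.eventually_nhds, hsub.eventually hZ.hasDerivAt_action] with h h1 h2
  exact (HasDerivAt.comp_const_sub E₀ h h2).congr_of_eventuallyEq h1

/-- The inverse of a normalizing map provides a Darboux chart in which `H` is in normal form. -/
lemma IsNormalizing.exists_isInverseBirkhoffNormalForm {Z : ℝ × ℝ → ℝ × ℝ} {I : ℝ → ℝ}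
    {P₀ : Fin 3 → ℝ} (hZ : IsNormalizing A B l Z I) (hA : 0 < A) (hB : 0 < B)
    (hl : 0 < l) (hσ : σ ^ 2 = 1) (hH : ∀ P, casimir P = l → H P = E₀ - halfSq (proj A B P))
    (hP₀ : P₀ = ![σ * √(2 * l), 0, 0]) :
    ∃ Φ, IsInverseBirkhoffNormalForm l H P₀ Φ := by
  have hdens : 0 < density A B l 0 := by
    rw [density, mul_zero, sub_zero]
    positivity
  obtain ⟨W, hW, hW0, hZW, -⟩ := exists_analyticAt_inverse hZ.analyticAt hZ.map_zero (by
    rw [hZ.det_fderiv.self_of_nhds, quad_zero]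
    exact hdens.ne')
  have hI' := hZ.deriv_action_ne_zero hA hB hl
  obtain ⟨G, hG, hG0, hIG, hGI⟩ := exists_analyticAt_inverse_real hZ.analyticAt_action hI'
  rw [hZ.action_zero] at hG hG0 hIG
  -- For `σ = -1` a reflection restores the orientation required of a Darboux chart, without
  -- changing `halfSq`.
  let R : ℝ × ℝ →L[ℝ] ℝ × ℝ :=
    (ContinuousLinearMap.fst ℝ ℝ ℝ).prod (σ • ContinuousLinearMap.snd ℝ ℝ ℝ)
  have hRdet : R.det = σ := by
    rw [det_clm_prod]
    simp [R]
  have hRt : Tendsto R (𝓝 0) (𝓝 0) := by simpa using R.continuous.tendsto 0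
  have hRsq : ∀ z, halfSq (R z) = halfSq z := by
    intro z
    simp [R, halfSq, mul_pow, hσ]
  let V : ℝ × ℝ → ℝ × ℝ := fun z => W (R z)
  have hV : AnalyticAt ℝ V 0 := hW.comp_of_eq (R.analyticAt 0) R.map_zero
  have hV0 : V 0 = 0 := by simp [V, hW0]
  have hVt : Tendsto V (𝓝 0) (𝓝 0) := by
    have := hV.continuousAt.tendsto
    rwa [hV0] at this
  have hrad : ∀ᶠ z in 𝓝 0, 0 < 2 * l - 2 * quad A B (V z) := by
    have : ∀ᶠ z in 𝓝 0, 0 < 2 * l - 2 * quad A B z := by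
      refine (continuousAt_const.sub (continuousAt_const.mul
        (analyticAt_quad A B 0).continuousAt)).eventually_const_lt ?_
      change 0 < 2 * l - 2 * quad A B 0
      rw [quad_zero]
      linarith
    exact hVt.eventually this
  have hcas : ∀ᶠ z in 𝓝 0, casimir (lift A B l σ (V z)) = l :=
    hrad.mono fun z hz => casimir_lift hA hB hσ hz.le
  have hlift : AnalyticAt ℝ (fun z => lift A B l σ (V z)) 0 :=
    (analyticAt_lift A B hl σ).comp_of_eq hV hV0
  -- The chart undoes the reflection-corrected `Z` and lifts to the hemisphere; since `halfSq =
  -- G(I)` there, the normal form is `E₀ - G`, with `G` the local inverse of the action.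
  refine ⟨fun h => I (E₀ - h), fun t => E₀ - G t, ⟨analyticAt_const.sub hG, ?_,
    fun z => lift A B l σ (V z), ⟨hlift, ?_, hcas, ?_⟩, ?_⟩, ?_, ?_⟩
  · have h1 := hG.differentiableAt.hasDerivAt
    rw [(h1.const_sub E₀).deriv]
    intro h2
    have h3 : HasDerivAt G (deriv G 0) (I 0) := by rwa [hZ.action_zero]
    have h4 := h3.comp 0 hZ.analyticAt_action.differentiableAt.hasDerivAt
    have h5 := h4.unique ((hasDerivAt_id (0 : ℝ)).congr_of_eventuallyEq hGI)
    rw [neg_eq_zero.1 h2, zero_mul] at h5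
    exact zero_ne_one h5
  · rw [hV0, hP₀, lift, quad_zero]
    simp
  · filter_upwards [hlift.eventually_analyticAt, hcas.eventually_nhds, hrad,
      hVt.eventually hZ.det_fderiv, hVt.eventually hZ.analyticAt.eventually_analyticAt,
      hRt.eventually hZW.eventually_nhds, hRt.eventually hW.eventually_analyticAt]
      with z h1 h2 h3 h4 h5 h6 h7
    have hpos : 0 < σ * lift A B l σ (V z) 0 := by
      have : σ * (σ * √(2 * l - 2 * quad A B (V z))) = √(2 * l - 2 * quad A B (V z)) := by
        rw [← mul_assoc, ← sq, hσ, one_mul]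
      simp only [lift, Matrix.cons_val_zero, this]
      exact Real.sqrt_pos.2 h3
    rw [orbitForm_fderiv_eq hA hB hσ h1.differentiableAt h2 hpos]
    simp only [proj_lift hA hB]
    have hVd : (fderiv ℝ V z).det = (fderiv ℝ W (R z)).det * σ := by
      have : fderiv ℝ V z = (fderiv ℝ W (R z)).comp R :=
        (h7.differentiableAt.hasFDerivAt.comp z R.hasFDerivAt).fderiv
      rw [this, ← hRdet]
      exact LinearMap.det_comp _ _
    -- The chain rule for `Z ∘ W = id`; the two factors `σ`, from the hemisphere and from `R`, then
    -- cancel.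
    have hZWd : (fderiv ℝ Z (V z)).det * (fderiv ℝ W (R z)).det = 1 := by
      have h8 := h5.differentiableAt.hasFDerivAt.comp (R z) h7.differentiableAt.hasFDerivAt
      have h9 := h8.unique ((hasFDerivAt_id (R z)).congr_of_eventuallyEq h6)
      have h10 : ((fderiv ℝ Z (V z)).comp (fderiv ℝ W (R z))).det = 1 := by
        rw [h9]
        exact LinearMap.det_id
      rw [← h10]
      exact (LinearMap.det_comp _ _).symm
    rw [← h4]
    change σ * ((fderiv ℝ Z (V z)).det * (fderiv ℝ V z).det) = 1
    rw [hVd]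
    linear_combination σ ^ 2 * hZWd + hσ
  · filter_upwards [hcas, hRt.eventually hZW, hVt.eventually hZ.halfSq_map,
      (tendsto_halfSq.comp hVt).eventually hGI] with z h1 h2 h3 h4
    rw [hH _ h1, proj_lift hA hB]
    change _ = E₀ - G (halfSq z)
    rw [← hRsq z, ← h2]
    change _ = E₀ - G (halfSq (Z (V z)))
    rw [h3]
    exact congrArg (E₀ - ·) h4.symm
  · filter_upwards [hIG] with t ht
    rw [sub_sub_cancel, ht]
  · have hsub : Tendsto (fun h => E₀ - h) (𝓝 E₀) (𝓝 0) := by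
      simpa using (by fun_prop : Continuous fun h : ℝ => E₀ - h).tendsto E₀
    simp only [hG0, sub_zero]
    filter_upwards [hsub.eventually hGI] with h hh
    rw [hh, sub_sub_cancel]

end

end FreeRigidBody

/-! ### Specialization to the two equilibria -/

/-- At each of the equilibria `(±√(2l), 0, 0)` an inverse Birkhoff normal form `Φ₁` of the
Hamiltonian exists, and the derivative of any such `Φ₁` is `S(1/I₁, 1/I₂, 1/I₃, h/l)` for all
energies `h` near the critical value `l/I₁`. -/
theorem theorem4p1 (I₁ I₂ I₃ l : ℝ) (hI₁ : 0 < I₁) (hI₁₂ : I₁ < I₂) (hI₂₃ : I₂ < I₃)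
    (hl : 0 < l) (P₀ : Fin 3 → ℝ)
    (hP₀ : P₀ = ![√(2 * l), 0, 0] ∨ P₀ = ![-√(2 * l), 0, 0]) :
    (∃ Φ₁ : ℝ → ℝ, FreeRigidBody.IsInverseBirkhoffNormalForm l
      (FreeRigidBody.energy I₁ I₂ I₃) P₀ Φ₁) ∧
    ∀ Φ₁ : ℝ → ℝ,
      FreeRigidBody.IsInverseBirkhoffNormalForm l (FreeRigidBody.energy I₁ I₂ I₃) P₀ Φ₁ →
      ∀ᶠ h in 𝓝 (l / I₁),
        HasDerivAt Φ₁ (FreeRigidBody.periodS l (1 / I₁) (1 / I₂) (1 / I₃) (h / l)) h := by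
  have hI₂ : 0 < I₂ := hI₁.trans hI₁₂
  have hba : 1 / I₂ < 1 / I₁ := one_div_lt_one_div_of_lt hI₁ hI₁₂
  have hcb : 1 / I₃ < 1 / I₂ := one_div_lt_one_div_of_lt hI₂ hI₂₃
  have hA : 0 < 1 / I₁ - 1 / I₂ := by linarith
  have hB : 0 < 1 / I₁ - 1 / I₃ := by linarith
  obtain ⟨σ, hσ, hP₀'⟩ : ∃ σ : ℝ, σ ^ 2 = 1 ∧ P₀ = ![σ * √(2 * l), 0, 0] := by
    rcases hP₀ with h | h
    · exact ⟨1, by norm_num, by simpa using h⟩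
    · exact ⟨-1, by norm_num, by simpa using h⟩
  obtain ⟨Z, I, hZ⟩ := FreeRigidBody.exists_isNormalizing hA hB hl
  have hH : ∀ P, FreeRigidBody.casimir P = l → FreeRigidBody.energy I₁ I₂ I₃ P = l / I₁ -
      FreeRigidBody.halfSq (FreeRigidBody.proj (1 / I₁ - 1 / I₂) (1 / I₁ - 1 / I₃) P) :=
    fun P hP => FreeRigidBody.energy_eq hA.le hB.le hP
  refine ⟨hZ.exists_isInverseBirkhoffNormalForm hA hB hl hσ hH hP₀', fun Φ₁ hΦ => ?_⟩
  -- Energies near `l/I₁` stay above the saddle value `l/I₂`, where the elliptic formula is valid.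
  have hnear : ∀ᶠ h in 𝓝 (l / I₁), 1 / I₂ * l < h := by
    refine eventually_gt_nhds ?_
    rw [div_eq_mul_one_div l, mul_comm]
    exact mul_lt_mul_of_pos_left hba hl
  filter_upwards [hZ.hasDerivAt_of_isInverseBirkhoffNormalForm hA hB hl hσ hH hP₀' hΦ, hnear]
    with h h1 h2
  rwa [div_eq_mul_one_div l I₁, FreeRigidBody.meanDensity_eq_neg_periodS hl hba hcb h2,
    neg_neg] at h1
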